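/- Let $\mathbb{K}$ be $\mathbb{R}$ or $\mathbb{C}$, and let $X\in\mathbb{K}^{N\times T}$ be a matrix of rank $r\ge 1$ with thin singular value decomposition $X=U\Sigma V^{*}$, where $U\in\mathbb{K}^{N\times r}$ and $V\in\mathbb{K}^{T\times r}$ have orthonormal columns and $\Sigma\in\mathbb{R}^{r\times r}$ is diagonal with the positive singular values on its diagonal. For a matrix $A$ put $\|A\|_{2,\infty}=\max_i\big(\sum_j|A(i,j)|^2\big)^{1/2}$. Suppose that $X$ is $\{\mu_1,\mu_2\}$-incoherent, that is, $1\le\mu_1\le N/r$, $1\le\mu_2\le T/r$, $$\frac{N}{r}\,\|U\|_{2,\infty}^2\le\mu_1\quad\text{and}\quad\frac{T}{r}\,\|V\|_{2,\infty}^2\le\mu_2 .$$ Let $0<\delta<1$ and $0<\epsilon<1$. Draw a set $\mathcal{I}\subseteq\{1,\dots,N\}$ of row indices and, independently, a set $\mathcal{J}\subseteq\{1,\dots,T\}$ of column indices, each uniformly without replacement and of a fixed size (that is, uniformly among all subsets of that size), where $$|\mathcal{I}|\ge 3r\mu_1\frac{\ln(2r/\delta)}{\epsilon^2},\qquad |\mathcal{J}|\ge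 3r\mu_2\frac{\ln(2r/\delta)}{\epsilon^2}.$$ Then the row submatrix $X(\mathcal{I},:)$ satisfies $\operatorname{rank}X(\mathcal{I},:)=r$ with probability at least $1-\delta$, and the submatrix $X(\mathcal{I},\mathcal{J})$ satisfies $\operatorname{rank}X(\mathcal{I},\mathcal{J})=r$ with probability at least $(1-\delta)^2$. -/

import Mathlib

open scoped Matrix

noncomputable section

/-- The largest row-wise `ℓ²`-norm `‖U‖_{2,∞}` of a matrix. -/
def twoInftyNorm {𝕜 : Type*} [RCLike 𝕜] {n r : ℕ} (U : Matrix (Fin n) (Fin r) 𝕜) : ℝ :=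
  ⨆ i : Fin n, Real.sqrt (∑ j : Fin r, ‖U i j‖ ^ 2)

/-- `X = U Σ Vᴴ` is a thin singular value decomposition with `r` positive singular values
`σ 0 ≥ σ 1 ≥ …`: `U` and `V` have orthonormal columns and `Σ = diag σ`. -/
structure IsThinSVD {𝕜 : Type*} [RCLike 𝕜] {N T r : ℕ} (X : Matrix (Fin N) (Fin T) 𝕜)
    (U : Matrix (Fin N) (Fin r) 𝕜) (σ : Fin r → ℝ) (V : Matrix (Fin T) (Fin r) 𝕜) : Prop where
  left_orthonormal : Uᴴ * U = 1
  right_orthonormal : Vᴴ * V = 1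
  pos : ∀ i, 0 < σ i
  antitone : Antitone σ
  eq : X = U * Matrix.diagonal (fun i => (σ i : 𝕜)) * Vᴴ

/-- `{μ₁, μ₂}`-incoherence of a rank-`r` matrix. The row norms of `U` and `V` do not depend on
the thin singular value decomposition chosen, so one decomposition is enough. -/
def IsIncoherent {𝕜 : Type*} [RCLike 𝕜] {N T : ℕ} (X : Matrix (Fin N) (Fin T) 𝕜) (r : ℕ)
    (μ₁ μ₂ : ℝ) : Prop :=
  (1 ≤ μ₁ ∧ μ₁ ≤ (N : ℝ) / r) ∧ (1 ≤ μ₂ ∧ μ₂ ≤ (T : ℝ) / r) ∧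
    ∃ (U : Matrix (Fin N) (Fin r) 𝕜) (σ : Fin r → ℝ) (V : Matrix (Fin T) (Fin r) 𝕜),
      IsThinSVD X U σ V ∧
      (N : ℝ) / r * twoInftyNorm U ^ 2 ≤ μ₁ ∧ (T : ℝ) / r * twoInftyNorm V ^ 2 ≤ μ₂

/-- A set of `m` indices drawn from `n` indices uniformly without replacement. -/
def uniformSubset (n m : ℕ) (h : m ≤ n) : PMF (Finset (Fin n)) :=
  PMF.uniformOfFinset (Finset.powersetCard m Finset.univ)
    (Finset.powersetCard_nonempty.2 (by simpa using h))

/-- Draw `m` of `N` row indices uniformly without replacement, then, independently, `l` of `T`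
column indices uniformly without replacement. -/
def subsetSampling (N T m l : ℕ) (hm : m ≤ N) (hl : l ≤ T) :
    PMF (Finset (Fin N) × Finset (Fin T)) :=
  (uniformSubset N m hm).bind fun I => (uniformSubset T l hl).map fun J => (I, J)

/-- The row submatrix `X(I, :)`. -/
def rowSubmatrix {𝕜 : Type*} {N T : ℕ} (X : Matrix (Fin N) (Fin T) 𝕜) (I : Finset (Fin N)) :
    Matrix I (Fin T) 𝕜 :=
  X.submatrix (fun i => (i : Fin N)) id

/-- The submatrix `X(I, J)`. -/
def rowColSubmatrix {𝕜 : Type*} {N T : ℕ} (X : Matrix (Fin N) (Fin T) 𝕜) (I : Finset (Fin N))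
    (J : Finset (Fin T)) : Matrix I J 𝕜 :=
  X.submatrix (fun i => (i : Fin N)) (fun j => (j : Fin T))

end

/-!
Adjoin the sampled row indices one at a time and follow the codimension of the span of the chosen
rows of `U`. The columns of `U` are orthonormal, so for every subspace `W` the projections of the
rows to `Wᗮ` have total squared length `codim W`; each of them has squared length at most `r μ / N`,
so at least `N codim W / (r μ)` rows lie outside `W`. A new random row therefore lowers the expected
codimension by a factor of at most `1 - 1 / (r μ) ≤ exp (-1 / (r μ))`; after `m` draws it is at most
`r exp (-m / (r μ))`, and by the first-moment method the codimension vanishes with probability at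
least `1 - δ` as soon as `m ≥ r μ log (r / δ)`. Rank `r` of the chosen rows of `U` passes to the
rows of `X = U Σ Vᴴ`, and, with independent rows of `V`, to the submatrix of `X`.
-/

section Averaging

open Finset
open scoped BigOperators

lemma sum_powersetCard_sum_compl_insert {ι M : Type*} [Fintype ι] [DecidableEq ι]
    [AddCommMonoid M] (f : Finset ι → M) (k : ℕ) :
    ∑ I ∈ powersetCard k univ, ∑ i ∈ Iᶜ, f (insert i I) =
      (k + 1) • ∑ I ∈ powersetCard (k + 1) univ, f I := by
  calc ∑ I ∈ powersetCard k univ, ∑ i ∈ Iᶜ, f (insert i I)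
      = ∑ J ∈ powersetCard (k + 1) univ, ∑ _j ∈ J, f J := by
        rw [sum_sigma', sum_sigma']
        refine sum_nbij' (fun p ↦ ⟨insert p.2 p.1, p.2⟩) (fun p ↦ ⟨p.1.erase p.2, p.2⟩)
          ?_ ?_ ?_ ?_ ?_ <;>
          simp +contextual [mem_powersetCard, card_erase_of_mem]
    _ = (k + 1) • ∑ J ∈ powersetCard (k + 1) univ, f J := by
        rw [smul_sum]
        refine sum_congr rfl fun J hJ ↦ ?_
        rw [sum_const, (mem_powersetCard.1 hJ).2]

lemma expect_powersetCard_succ {ι : Type*} [Fintype ι] [DecidableEq ι] (f : Finset ι → ℝ) (k : ℕ) :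
    𝔼 I ∈ powersetCard (k + 1) univ, f I =
      𝔼 I ∈ powersetCard k univ, 𝔼 i ∈ Iᶜ, f (insert i I) := by
  have hinner : ∀ I ∈ powersetCard k (univ : Finset ι), 𝔼 i ∈ Iᶜ, f (insert i I) =
      (∑ i ∈ Iᶜ, f (insert i I)) / (Fintype.card ι - k : ℕ) := fun I hI ↦ by
    rw [expect_eq_sum_div_card, card_compl, (mem_powersetCard.1 hI).2]
  have hchoose : ((Fintype.card ι).choose k : ℝ) * (Fintype.card ι - k : ℕ) =
      (k + 1) * (Fintype.card ι).choose (k + 1) := by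
    rw [mul_comm ((k : ℝ) + 1)]
    exact_mod_cast (Nat.choose_succ_right_eq _ _).symm
  rw [expect_congr rfl hinner, ← expect_div, expect_eq_sum_div_card, expect_eq_sum_div_card,
    sum_powersetCard_sum_compl_insert, card_powersetCard, card_powersetCard, card_univ, div_div,
    hchoose, nsmul_eq_mul, Nat.cast_succ, mul_div_mul_left _ _ (by positivity)]

lemma ofReal_one_sub_expect_le_toOuterMeasure_uniformOfFinset {α : Type*} {s : Finset α}
    (hs : s.Nonempty) (f : α → ℕ) :
    ENNReal.ofReal (1 - 𝔼 x ∈ s, (f x : ℝ)) ≤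
      (PMF.uniformOfFinset s hs).toOuterMeasure {x | f x = 0} := by
  have hcard : (0 : ℝ) < #s := by exact_mod_cast hs.card_pos
  have hcount : (#s : ℝ) ≤ #{x ∈ s | f x = 0} + ∑ x ∈ s, (f x : ℝ) := by
    norm_cast
    rw [card_filter, ← sum_add_distrib, card_eq_sum_ones]
    exact sum_le_sum fun x _ ↦ by split_ifs <;> omega
  calc ENNReal.ofReal (1 - 𝔼 x ∈ s, (f x : ℝ))
      ≤ ENNReal.ofReal (#{x ∈ s | f x = 0} / #s) := by
        refine ENNReal.ofReal_le_ofReal ?_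
        rw [expect_eq_sum_div_card, sub_le_iff_le_add, ← add_div, one_le_div hcard]
        exact hcount
    _ = (PMF.uniformOfFinset s hs).toOuterMeasure {x | f x = 0} := by
        rw [ENNReal.ofReal_div_of_pos hcard, ENNReal.ofReal_natCast, ENNReal.ofReal_natCast,
          PMF.toOuterMeasure_uniformOfFinset_apply]
        simp only [Set.mem_ofPred_eq]

lemma toOuterMeasure_bind_map_prodMk {α β : Type*} (p : PMF α) (q : PMF β) (A : Set α)
    (B : Set β) :
    (p.bind fun a ↦ q.map fun b ↦ (a, b)).toOuterMeasure (A ×ˢ B) =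
      p.toOuterMeasure A * q.toOuterMeasure B := by
  rw [PMF.toOuterMeasure_bind_apply, PMF.toOuterMeasure_apply (s := A), ← ENNReal.tsum_mul_right]
  refine tsum_congr fun a ↦ ?_
  rw [PMF.toOuterMeasure_map_apply]
  by_cases ha : a ∈ A
  · rw [Set.indicator_of_mem ha, Set.mk_preimage_prod_right ha]
  · rw [Set.indicator_of_notMem ha, Set.mk_preimage_prod_right_eq_empty ha,
      MeasureTheory.measure_empty, mul_zero, zero_mul]

end Averaging

section Spread

open Finset Module Submodule
open scoped BigOperators

variable {K E F ι : Type*} [DivisionRing K] [AddCommGroup E] [Module K E]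
  [AddCommGroup F] [Module K F]

/-- The codimension of the span of the vectors `u i` with `i ∈ I`: the quantity that random sampling
of `I` has to bring down to `0`. -/
noncomputable def spanCodim (K : Type*) [DivisionRing K] [Module K E] (u : ι → E)
    (I : Finset ι) : ℕ :=
  finrank K (E ⧸ span K (u '' I))

open Classical in
lemma spanCodim_insert_add_le [Module.Finite K E] [DecidableEq ι] (u : ι → E) (I : Finset ι)
    (i : ι) :
    spanCodim K u (insert i I) + (if u i ∉ span K (u '' I) then 1 else 0) ≤ spanCodim K u I := by
  have hle : span K (u '' I) ≤ span K (u '' (insert i I : Finset ι)) :=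
    span_mono (Set.image_mono (by simp))
  have hdim := (span K (u '' I)).finrank_quotient_add_finrank
  have hdim' := (span K (u '' (insert i I : Finset ι))).finrank_quotient_add_finrank
  unfold spanCodim
  split_ifs with hi
  · have := finrank_mono hle
    omega
  · have hlt : span K (u '' I) < span K (u '' (insert i I : Finset ι)) :=
      SetLike.lt_iff_le_and_exists.2 ⟨hle, u i, subset_span ⟨i, by simp, rfl⟩, hi⟩
    have := finrank_lt_finrank_of_lt hlt
    omega

open Classical in
/-- A finite family of vectors is `c`-spread if a uniformly random member lies outside each
subspace `W` with probability at least `codim W / c`. For the rows of a matrix with `r` orthonormal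
columns, the best `c` is at most `r` times the coherence. -/
def IsSpread (K : Type*) [DivisionRing K] [Module K E] [Fintype ι] (u : ι → E) (c : ℝ) : Prop :=
  ∀ W : Submodule K E, (Fintype.card ι * finrank K (E ⧸ W) : ℝ) ≤ c * #{i | u i ∉ W}

variable [Fintype ι] {u : ι → E} {c : ℝ}

lemma IsSpread.map (hu : IsSpread K u c) (e : E ≃ₗ[K] F) : IsSpread K (e ∘ u) c := fun W ↦ by
  have hcodim : finrank K (E ⧸ W.comap e.toLinearMap) = finrank K (F ⧸ W) :=
    (Quotient.equiv _ _ e (map_comap_eq_of_surjective e.surjective W)).finrank_eq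
  rw [← hcodim]
  exact hu (W.comap e.toLinearMap)

variable [Module.Finite K E]

lemma IsSpread.expect_spanCodim_insert_le [DecidableEq ι] (hu : IsSpread K u c) (hc : 0 ≤ c)
    (I : Finset ι) :
    𝔼 i ∈ Iᶜ, (spanCodim K u (insert i I) : ℝ) ≤ Real.exp (-1 / c) * spanCodim K u I := by
  classical
  have hmiss : (#Iᶜ : ℝ) * spanCodim K u I / c ≤ #{i | u i ∉ span K (u '' I)} := by
    refine div_le_of_le_mul₀ hc (Nat.cast_nonneg _) ?_
    calc (#Iᶜ : ℝ) * spanCodim K u I ≤ Fintype.card ι * spanCodim K u I := by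
          gcongr
          exact card_le_univ _
      _ ≤ #{i | u i ∉ span K (u '' I)} * c := (hu _).trans_eq (mul_comm _ _)
  have hcompl : #{i | u i ∉ span K (u '' I)} = #{i ∈ Iᶜ | u i ∉ span K (u '' I)} := by
    congr 1
    ext i
    simpa using fun hi hiI ↦ hi (subset_span ⟨i, hiI, rfl⟩)
  have hsum : ∑ i ∈ Iᶜ, spanCodim K u (insert i I) + #{i | u i ∉ span K (u '' I)} ≤
      #Iᶜ * spanCodim K u I := by
    rw [hcompl, card_filter, ← sum_add_distrib, ← smul_eq_mul, ← sum_const]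
    exact sum_le_sum fun i _ ↦ spanCodim_insert_add_le u I i
  rw [expect_eq_sum_div_card]
  refine div_le_of_le_mul₀ (Nat.cast_nonneg _) (by positivity) ?_
  calc ∑ i ∈ Iᶜ, (spanCodim K u (insert i I) : ℝ)
      ≤ #Iᶜ * spanCodim K u I - #{i | u i ∉ span K (u '' I)} := by
        rw [le_sub_iff_add_le]
        exact_mod_cast hsum
    _ ≤ (-1 / c + 1) * (#Iᶜ * spanCodim K u I) := by
        linear_combination hmiss
    _ ≤ Real.exp (-1 / c) * (#Iᶜ * spanCodim K u I) := by
        gcongr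
        exact Real.add_one_le_exp _
    _ = Real.exp (-1 / c) * spanCodim K u I * #Iᶜ := by ring

lemma IsSpread.expect_spanCodim_le (hu : IsSpread K u c) (hc : 0 ≤ c) (k : ℕ) :
    𝔼 I ∈ powersetCard k univ, (spanCodim K u I : ℝ) ≤
      Real.exp (-1 / c) ^ k * finrank K E := by
  classical
  induction k with
  | zero => simpa [spanCodim] using finrank_quotient_le (span K (u '' (∅ : Finset ι)))
  | succ k ih =>
    rw [expect_powersetCard_succ]
    calc 𝔼 I ∈ powersetCard k univ, 𝔼 i ∈ Iᶜ, (spanCodim K u (insert i I) : ℝ)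
        ≤ 𝔼 I ∈ powersetCard k univ, Real.exp (-1 / c) * spanCodim K u I :=
          expect_le_expect fun I _ ↦ hu.expect_spanCodim_insert_le hc I
      _ = Real.exp (-1 / c) * 𝔼 I ∈ powersetCard k univ, (spanCodim K u I : ℝ) :=
          (mul_expect _ _ _).symm
      _ ≤ Real.exp (-1 / c) * (Real.exp (-1 / c) ^ k * finrank K E) := by gcongr
      _ = Real.exp (-1 / c) ^ (k + 1) * finrank K E := by ring

end Spread

section OrthonormalColumns

open Finset Module
open scoped InnerProductSpace

variable {𝕜 : Type*} [RCLike 𝕜]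

/-- Summing the frame inequality over an orthonormal basis of `Wᗮ` bounds `codim W` by the total
squared length of the projections of the `u i` to `Wᗮ`, and only the `u i` outside `W`
contribute. -/
lemma isSpread_of_norm_sq_le_sum_norm_inner_sq {E ι : Type*} [NormedAddCommGroup E]
    [InnerProductSpace 𝕜 E] [FiniteDimensional 𝕜 E] [Fintype ι] {u : ι → E} {c : ℝ}
    (hframe : ∀ x : E, ‖x‖ ^ 2 ≤ ∑ i, ‖⟪x, u i⟫_𝕜‖ ^ 2)
    (hc : ∀ i, Fintype.card ι * ‖u i‖ ^ 2 ≤ c) : IsSpread 𝕜 u c := fun W ↦ by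
  classical
  have hcodim : finrank 𝕜 (E ⧸ W) = finrank 𝕜 Wᗮ := by
    have := W.finrank_quotient_add_finrank
    have := W.finrank_add_finrank_orthogonal
    omega
  let b := stdOrthonormalBasis 𝕜 Wᗮ
  have hb : Orthonormal 𝕜 fun k ↦ (b k : E) :=
    b.orthonormal.comp_linearIsometry Wᗮ.subtypeₗᵢ
  have hproj (i : ι) : Fintype.card ι * ∑ k, ‖⟪(b k : E), u i⟫_𝕜‖ ^ 2 ≤
      if u i ∉ W then c else 0 := by
    split_ifs with hi
    · simp [Submodule.inner_left_of_mem_orthogonal hi (b _).2]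
    · exact (mul_le_mul_of_nonneg_left (hb.sum_inner_products_le (u i))
        (Nat.cast_nonneg _)).trans (hc i)
  calc (Fintype.card ι * finrank 𝕜 (E ⧸ W) : ℝ)
      = Fintype.card ι * ∑ k, ‖(b k : E)‖ ^ 2 := by simp [hb.1, hcodim]
    _ ≤ Fintype.card ι * ∑ k, ∑ i, ‖⟪(b k : E), u i⟫_𝕜‖ ^ 2 := by
        gcongr with k
        exact hframe (b k)
    _ = ∑ i, Fintype.card ι * ∑ k, ‖⟪(b k : E), u i⟫_𝕜‖ ^ 2 := by rw [sum_comm, mul_sum]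
    _ ≤ ∑ i, if u i ∉ W then c else 0 := sum_le_sum fun i _ ↦ hproj i
    _ = c * #{i | u i ∉ W} := by rw [← sum_filter, sum_const, nsmul_eq_mul, mul_comm]

variable {ι κ : Type*} [Fintype ι] [Fintype κ] [DecidableEq κ] {U : Matrix ι κ 𝕜}

lemma sum_norm_mulVec_sq (hU : Uᴴ * U = 1) (v : κ → 𝕜) :
    ∑ i, ‖(U *ᵥ v) i‖ ^ 2 = ∑ j, ‖v j‖ ^ 2 := by
  have hdot : star (U *ᵥ v) ⬝ᵥ (U *ᵥ v) = star v ⬝ᵥ v := by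
    rw [Matrix.star_mulVec, ← Matrix.dotProduct_mulVec, Matrix.mulVec_mulVec, hU,
      Matrix.one_mulVec]
  simp only [dotProduct, Pi.star_apply, RCLike.star_def, RCLike.conj_mul] at hdot
  exact_mod_cast hdot

lemma isSpread_row (hU : Uᴴ * U = 1) {c : ℝ}
    (hc : ∀ i, Fintype.card ι * ∑ j, ‖U i j‖ ^ 2 ≤ c) : IsSpread 𝕜 U.row c := by
  have hinner (x : EuclideanSpace 𝕜 κ) (i : ι) :
      ⟪x, WithLp.toLp 2 (U.row i)⟫_𝕜 = (U *ᵥ star x.ofLp) i := by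
    simp [PiLp.inner_apply, Matrix.mulVec, dotProduct]
  have hspread : IsSpread 𝕜 (fun i ↦ (WithLp.toLp 2 (U.row i) : EuclideanSpace 𝕜 κ)) c :=
    isSpread_of_norm_sq_le_sum_norm_inner_sq
      (fun x ↦ by simp [hinner, sum_norm_mulVec_sq hU, EuclideanSpace.norm_sq_eq])
      (fun i ↦ by simpa [EuclideanSpace.norm_sq_eq] using hc i)
  exact hspread.map (WithLp.linearEquiv 2 𝕜 (κ → 𝕜))

end OrthonormalColumns

section Rank

open Module

variable {K : Type*} [Field K]

lemma rank_rowSubmatrix_add_spanCodim {N T : ℕ} (X : Matrix (Fin N) (Fin T) K)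
    (I : Finset (Fin N)) : (rowSubmatrix X I).rank + spanCodim K X.row I = T := by
  have hrows : Set.range (rowSubmatrix X I).row = X.row '' I := by
    rw [Set.image_eq_range]
    rfl
  rw [Matrix.rank_eq_finrank_span_row, hrows, spanCodim, add_comm,
    Submodule.finrank_quotient_add_finrank, finrank_fin_fun]

variable {m n κ : Type*} [Fintype κ]

lemma rank_eq_card_of_mul_eq_one [Fintype m] [DecidableEq κ] {L : Matrix κ m K} {A : Matrix m κ K}
    (h : L * A = 1) : A.rank = Fintype.card κ := by
  refine A.rank_le_card_width.antisymm ?_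
  rw [← Matrix.rank_one (R := K) (n := κ), ← h]
  exact Matrix.rank_mul_le_right L A

variable [Fintype n]

lemma rank_mul_eq_right_of_rank_eq_card {A : Matrix m κ K} (hA : A.rank = Fintype.card κ)
    (B : Matrix κ n K) : (A * B).rank = B.rank := by
  have hinj : Function.Injective A.mulVecLin := by
    rw [← LinearMap.ker_eq_bot, ← Submodule.finrank_eq_zero (R := K)]
    have := A.mulVecLin.finrank_range_add_finrank_ker
    rw [← Matrix.rank, hA, finrank_fintype_fun_eq_card] at this
    omega
  rw [Matrix.rank, Matrix.rank, Matrix.mulVecLin_mul, LinearMap.range_comp,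
    ← (Submodule.equivMapOfInjective A.mulVecLin hinj _).finrank_eq]

lemma rank_mul_diagonal_mul [DecidableEq κ] {A : Matrix m κ K} (hA : A.rank = Fintype.card κ)
    {d : κ → K} (hd : ∀ i, d i ≠ 0) (B : Matrix κ n K) :
    (A * Matrix.diagonal d * B).rank = B.rank := by
  have hdet : (Matrix.diagonal d).det ≠ 0 := by
    rw [Matrix.det_diagonal]
    exact Finset.prod_ne_zero_iff.2 fun i _ ↦ hd i
  rw [Matrix.mul_assoc, rank_mul_eq_right_of_rank_eq_card hA,
    Matrix.rank_mul_eq_right_of_det_ne_zero _ _ hdet]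

end Rank

section ThinSVD

variable {𝕜 : Type*} [RCLike 𝕜] {N T r : ℕ} {X : Matrix (Fin N) (Fin T) 𝕜}
  {U : Matrix (Fin N) (Fin r) 𝕜} {σ : Fin r → ℝ} {V : Matrix (Fin T) (Fin r) 𝕜}

open scoped ComplexOrder in
lemma IsThinSVD.rank_submatrix (h : IsThinSVD X U σ V) {m n : Type*} [Fintype n] {f : m → Fin N}
    (hf : (U.submatrix f id).rank = r) (g : n → Fin T) :
    (X.submatrix f g).rank = (V.submatrix g id).rank := by
  have hσ (i : Fin r) : (σ i : 𝕜) ≠ 0 := RCLike.ofReal_ne_zero.2 (h.pos i).ne'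
  have hfactor : X.submatrix f g =
      U.submatrix f id * Matrix.diagonal (fun i ↦ (σ i : 𝕜)) * (V.submatrix g id)ᴴ := by
    rw [h.eq]
    rfl
  rw [hfactor, rank_mul_diagonal_mul (by simpa using hf) hσ, Matrix.rank_conjTranspose]

lemma IsThinSVD.rank_rowSubmatrix (h : IsThinSVD X U σ V) {I : Finset (Fin N)}
    (hI : (rowSubmatrix U I).rank = r) : (rowSubmatrix X I).rank = r :=
  (h.rank_submatrix hI id).trans <| by simpa using rank_eq_card_of_mul_eq_one h.right_orthonormal

lemma IsThinSVD.rank_rowColSubmatrix (h : IsThinSVD X U σ V) {I : Finset (Fin N)}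
    {J : Finset (Fin T)} (hI : (rowSubmatrix U I).rank = r) (hJ : (rowSubmatrix V J).rank = r) :
    (rowColSubmatrix X I J).rank = r :=
  (h.rank_submatrix hI _).trans hJ

end ThinSVD

section Sampling

variable {𝕜 : Type*} [RCLike 𝕜] {N T r : ℕ}

lemma sum_norm_sq_le_twoInftyNorm_sq (U : Matrix (Fin N) (Fin r) 𝕜) (i : Fin N) :
    ∑ j, ‖U i j‖ ^ 2 ≤ twoInftyNorm U ^ 2 := by
  have hrow : √(∑ j, ‖U i j‖ ^ 2) ≤ twoInftyNorm U :=
    le_ciSup (f := fun i ↦ √(∑ j, ‖U i j‖ ^ 2)) (Set.finite_range _).bddAbove i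
  exact (Real.sqrt_le_left (hrow.trans' (Real.sqrt_nonneg _))).1 hrow

lemma ofReal_one_sub_le_uniformSubset_rank_eq {U : Matrix (Fin N) (Fin r) 𝕜} (hU : Uᴴ * U = 1)
    {c : ℝ} (hc : N * twoInftyNorm U ^ 2 ≤ c) {m : ℕ} (hm : m ≤ N) :
    ENNReal.ofReal (1 - Real.exp (-1 / c) ^ m * r) ≤
      (uniformSubset N m hm).toOuterMeasure {I | (rowSubmatrix U I).rank = r} := by
  have hspread : IsSpread 𝕜 U.row c := isSpread_row hU fun i ↦ by
    rw [Fintype.card_fin]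
    exact (mul_le_mul_of_nonneg_left (sum_norm_sq_le_twoInftyNorm_sq U i)
      (Nat.cast_nonneg N)).trans hc
  have hexpect := hspread.expect_spanCodim_le (hc.trans' (by positivity)) m
  rw [Module.finrank_fin_fun] at hexpect
  have hrank (I : Finset (Fin N)) : (rowSubmatrix U I).rank = r ↔ spanCodim 𝕜 U.row I = 0 := by
    have := rank_rowSubmatrix_add_spanCodim U I
    omega
  simp only [hrank]
  exact (ENNReal.ofReal_le_ofReal (sub_le_sub_left hexpect 1)).trans
    (ofReal_one_sub_expect_le_toOuterMeasure_uniformOfFinset _ _)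

lemma exp_pow_mul_le_of_mul_log_le {c x δ : ℝ} (hc : 0 < c) (hx : 0 < x) (hδ : 0 < δ) {m : ℕ}
    (hm : c * Real.log (x / δ) ≤ m) : Real.exp (-1 / c) ^ m * x ≤ δ := by
  have hlog : x / δ ≤ Real.exp (m / c) := by
    rwa [← Real.log_le_iff_le_exp (by positivity), le_div_iff₀' hc]
  calc Real.exp (-1 / c) ^ m * x = x / Real.exp (m / c) := by
        rw [← Real.exp_nat_mul, mul_comm, div_eq_mul_inv x, ← Real.exp_neg]
        ring_nf
    _ ≤ δ := by rwa [div_le_comm₀ (Real.exp_pos _) hδ]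

lemma ofReal_one_sub_le_uniformSubset_rank_eq_of_incoherent {U : Matrix (Fin N) (Fin r) 𝕜}
    (hU : Uᴴ * U = 1) (hr : 0 < r) {μ : ℝ} (hμ : 0 < μ) (hinc : N / r * twoInftyNorm U ^ 2 ≤ μ)
    {δ : ℝ} (hδ : 0 < δ) {m : ℕ} (hm : m ≤ N) (hmlog : r * μ * Real.log (r / δ) ≤ m) :
    ENNReal.ofReal (1 - δ) ≤
      (uniformSubset N m hm).toOuterMeasure {I | (rowSubmatrix U I).rank = r} := by
  have hr' : (0 : ℝ) < r := by exact_mod_cast hr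
  have hnorm : N * twoInftyNorm U ^ 2 ≤ r * μ := by
    rwa [div_mul_eq_mul_div, div_le_iff₀' hr'] at hinc
  have hfail := exp_pow_mul_le_of_mul_log_le (mul_pos hr' hμ) hr' hδ hmlog
  exact (ENNReal.ofReal_le_ofReal (sub_le_sub_left hfail 1)).trans
    (ofReal_one_sub_le_uniformSubset_rank_eq hU hnorm hm)

lemma mul_log_div_le_three_mul_log_div_sq {x μ δ ε : ℝ} (hx : 1 ≤ x) (hμ : 0 ≤ μ) (hδ₀ : 0 < δ)
    (hδ₁ : δ ≤ 1) (hε₀ : 0 < ε) (hε₁ : ε ≤ 1) :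
    x * μ * Real.log (x / δ) ≤ 3 * x * μ * (Real.log (2 * x / δ) / ε ^ 2) := by
  have hlog : Real.log (x / δ) ≤ Real.log (2 * x / δ) := by
    gcongr
    linarith
  have hlog₀ : 0 ≤ Real.log (x / δ) := Real.log_nonneg <| (one_le_div hδ₀).2 (hδ₁.trans hx)
  have hε : Real.log (2 * x / δ) ≤ Real.log (2 * x / δ) / ε ^ 2 :=
    le_div_self (hlog₀.trans hlog) (by positivity) (pow_le_one₀ hε₀.le hε₁)
  calc x * μ * Real.log (x / δ) ≤ x * μ * (3 * (Real.log (2 * x / δ) / ε ^ 2)) := by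
        gcongr
        linarith
    _ = 3 * x * μ * (Real.log (2 * x / δ) / ε ^ 2) := by ring

lemma IsIncoherent.rank_pos {X : Matrix (Fin N) (Fin T) 𝕜} {μ₁ μ₂ : ℝ}
    (hX : IsIncoherent X r μ₁ μ₂) : 0 < r := by
  obtain ⟨⟨hμ₁, hμ₁N⟩, -⟩ := hX
  refine Nat.pos_of_ne_zero fun hr ↦ ?_
  rw [hr, Nat.cast_zero, div_zero] at hμ₁N
  linarith

end Sampling

theorem mainTheorem2_general {𝕜 : Type*} [RCLike 𝕜] {N T : ℕ} {X : Matrix (Fin N) (Fin T) 𝕜}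
    {r : ℕ} {μ₁ μ₂ : ℝ} (hX : IsIncoherent X r μ₁ μ₂) {δ : ℝ} (hδ₀ : 0 < δ) (hδ₁ : δ ≤ 1)
    {m l : ℕ} (hm : m ≤ N) (hl : l ≤ T)
    (hI : r * μ₁ * Real.log (r / δ) ≤ m) (hJ : r * μ₂ * Real.log (r / δ) ≤ l) :
    ENNReal.ofReal (1 - δ) ≤
        (subsetSampling N T m l hm hl).toOuterMeasure
          {p | (rowSubmatrix X p.1).rank = r} ∧
      ENNReal.ofReal ((1 - δ) ^ 2) ≤
        (subsetSampling N T m l hm hl).toOuterMeasure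
          {p | (rowColSubmatrix X p.1 p.2).rank = r} := by
  have hr := hX.rank_pos
  obtain ⟨⟨hμ₁, -⟩, ⟨hμ₂, -⟩, U, σ, V, hsvd, hU, hV⟩ := hX
  have hrow := ofReal_one_sub_le_uniformSubset_rank_eq_of_incoherent hsvd.left_orthonormal hr
    (by linarith) hU hδ₀ hm hI
  have hcol := ofReal_one_sub_le_uniformSubset_rank_eq_of_incoherent hsvd.right_orthonormal hr
    (by linarith) hV hδ₀ hl hJ
  constructor
  · have huniv : (uniformSubset T l hl).toOuterMeasure Set.univ = 1 :=
      (PMF.toOuterMeasure_apply_eq_one_iff _ _).2 (Set.subset_univ _)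
    rw [← mul_one (ENNReal.ofReal _), ← huniv]
    refine (mul_le_mul_left hrow _).trans ?_
    rw [← toOuterMeasure_bind_map_prodMk]
    exact MeasureTheory.measure_mono fun p hp ↦ hsvd.rank_rowSubmatrix hp.1
  · rw [sq, ENNReal.ofReal_mul (sub_nonneg.2 hδ₁)]
    refine (mul_le_mul' hrow hcol).trans ?_
    rw [← toOuterMeasure_bind_map_prodMk]
    exact MeasureTheory.measure_mono fun p hp ↦ hsvd.rank_rowColSubmatrix hp.1 hp.2

theorem mainTheorem2 {𝕜 : Type*} [RCLike 𝕜] {N T : ℕ} (X : Matrix (Fin N) (Fin T) 𝕜)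
    (r : ℕ) (hr : 0 < r) (hrank : X.rank = r)
    (μ₁ μ₂ : ℝ) (hX : IsIncoherent X r μ₁ μ₂)
    (δ ε : ℝ) (hδ₀ : 0 < δ) (hδ₁ : δ < 1) (hε₀ : 0 < ε) (hε₁ : ε < 1)
    (m l : ℕ) (hm : m ≤ N) (hl : l ≤ T)
    (hI : 3 * r * μ₁ * (Real.log (2 * r / δ) / ε ^ 2) ≤ (m : ℝ))
    (hJ : 3 * r * μ₂ * (Real.log (2 * r / δ) / ε ^ 2) ≤ (l : ℝ)) :
    ENNReal.ofReal (1 - δ) ≤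
        (subsetSampling N T m l hm hl).toOuterMeasure
          {p | (rowSubmatrix X p.1).rank = r} ∧
      ENNReal.ofReal ((1 - δ) ^ 2) ≤
        (subsetSampling N T m l hm hl).toOuterMeasure
          {p | (rowColSubmatrix X p.1 p.2).rank = r} := by
  have hr₁ : (1 : ℝ) ≤ r := by exact_mod_cast hr
  have hsize {μ : ℝ} (hμ : 1 ≤ μ) :=
    mul_log_div_le_three_mul_log_div_sq hr₁ (zero_le_one.trans hμ) hδ₀ hδ₁.le hε₀ hε₁.le
  exact mainTheorem2_general hX hδ₀ hδ₁.le hm hl ((hsize hX.1.1).trans hI)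
    ((hsize hX.2.1.1).trans hJ)
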